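/- Let $A$ be a unital $C^*$-algebra (for instance a von Neumann algebra) with a faithful state $\tau$ (for instance a normal faithful tracial state); no trace property is needed. Operators $a_1,\dots,a_n\in A$ are called freely independent if the unital $*$-subalgebras $A_i$ generated by $a_i$ are free with respect to $\tau$: $\tau(b_1\cdots b_m)=0$ whenever $m\ge 1$, $b_k\in A_{i_k}$, $\tau(b_k)=0$ for all $k$, and $i_k\ne i_{k+1}$ for $1\le k<m$. For $\mathcal A=(a_1,\dots,a_n)$ put $$\mathbb E_{wo,d}(\mathcal A)=\frac{(n-d)!}{n!}\sum_{j_1,\dots,j_d\ \text{all different}}a_{j_1}^*\cdots a_{j_d}^*a_{j_d}\cdots a_{j_1},\qquad \mathbb E_{wr,d}(\mathcal A)=\frac1{n^d}\sum_{j_1,\dots,j_d=1}^n a_{j_1}^*\cdots a_{j_d}^*a_{j_d}\cdots a_{j_1}.$$ Then for every $M$ there is a constant $K$, depending only on $M$, such that the following holds for all such $(A,\tau)$, all $n$, $d$ with $2d\le n$, all $\varepsilon$ with $d\varepsilon\le M$, and all freely independent $a_1,\dots,a_n\in A$ with $\tau(a_i^*a_i)=1$ for all $i$. If $$\frac1n\Big\|\sum_{i=1}^n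 a_i^*a_i-\tau\Big(\sum_{i=1}^n a_i^*a_i\Big)1\Big\|\le\varepsilon,$$ then, in operator norm, 1. $\big\|\mathbb E_{wo,d}(\mathcal A)-\tau(\mathbb E_{wo,d}(\mathcal A))1\big\|\le K\,d\varepsilon$; 2. $\|\mathbb E_{wo,d}(\mathcal A)\|\le(1+K\,d\varepsilon)\,\|\mathbb E_{wr,d}(\mathcal A)\|$. -/

import Mathlib

open scoped BigOperators Nat ComplexOrder

/-- A faithful state on a unital C⋆-algebra: a positive linear functional with `τ 1 = 1` which
vanishes at `x⋆ x` only for `x = 0`. -/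
structure IsFaithfulState {A : Type*} [CStarAlgebra A] [PartialOrder A] [StarOrderedRing A]
    (τ : A →ₚ[ℂ] ℂ) : Prop where
  map_one : τ 1 = 1
  faithful : ∀ x : A, τ (star x * x) = 0 → x = 0

/-- Free independence of a family of unital ⋆-subalgebras with respect to `τ`: a product of
finitely many (at least one) centred elements, neighbouring factors of which are taken from
subalgebras with different indices, is again centred. -/
def FreelyIndependentSubalgebras {ι A : Type*} [CStarAlgebra A] [PartialOrder A]
    [StarOrderedRing A] (τ : A →ₚ[ℂ] ℂ) (B : ι → StarSubalgebra ℂ A) : Prop :=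
  ∀ (m : ℕ) (i : Fin (m + 1) → ι) (b : Fin (m + 1) → A),
    (∀ k : Fin m, i k.castSucc ≠ i k.succ) →
    (∀ k, b k ∈ B (i k)) →
    (∀ k, τ (b k) = 0) →
    τ (List.ofFn b).prod = 0

/-- Operators `a i` are freely independent when the unital ⋆-algebras that they generate are. -/
def FreelyIndependent {ι A : Type*} [CStarAlgebra A] [PartialOrder A]
    [StarOrderedRing A] (τ : A →ₚ[ℂ] ℂ) (a : ι → A) : Prop :=
  FreelyIndependentSubalgebras τ (fun i => StarAlgebra.adjoin ℂ {a i})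

/-- The symmetrized word `x_{j_1}⋆ ⋯ x_{j_d}⋆ x_{j_d} ⋯ x_{j_1}`. -/
def symmetrizedWord {A : Type*} [CStarAlgebra A] {n d : ℕ} (x : Fin n → A)
    (j : Fin d → Fin n) : A :=
  (List.ofFn fun k => star (x (j k))).prod * (List.ofFn fun k => x (j k)).reverse.prod

/-- The without-replacement expectation: the average of the symmetrized words over all `d`-tuples
of pairwise different indices. -/
noncomputable def expectationWO {A : Type*} [CStarAlgebra A] {n : ℕ} (d : ℕ) (x : Fin n → A) : A :=
  (((n - d)! : ℂ) / (n ! : ℂ)) • ∑ j : Fin d ↪ Fin n, symmetrizedWord x j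

/-- The with-replacement expectation: the average of the symmetrized words over all `d`-tuples
of indices. -/
noncomputable def expectationWR {A : Type*} [CStarAlgebra A] {n : ℕ} (d : ℕ) (x : Fin n → A) : A :=
  ((n : ℂ) ^ d)⁻¹ • ∑ j : Fin d → Fin n, symmetrizedWord x j

/-! Freeness makes every partial sum of the centred elements `x i = star (a i) * a i - 1` obey the
one-sided bounds of the full sum: morally, the partial sum over `s` is the conditional expectation
of the full sum onto the algebra of the indices in `s`. No conditional expectation is constructed.
If the full sum is at most `r`, then `τ (star v * (r - ∑ i ∈ s, x i) * v) ≥ 0` for `v` in that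
algebra, since the missing terms contribute zero; faithfulness turns this into `∑ i ∈ s, x i ≤ r`.

In a word with distinct indices, the innermost index runs over the complement of the `d` others, so
its sum is `n - d` up to `n * ε`, a relative error of at most `2 * ε` as `n ≤ 2 * (n - d)`.
Induction on `d` traps `expectationWO` between scalars. Comparison with a scalar lower bound for
`expectationWR` gives the second claim for small `ε`; for large `ε`, `d` is bounded by `2 * M` and a
crude count suffices. -/

/-! ### Reduced words and freeness -/

section Words

variable {ι A : Type*} [CStarAlgebra A] [PartialOrder A]

/-- A word is reduced over `I` when its letters are centred, carry indices in `I`, and neighbouring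
letters carry different indices. -/
noncomputable def IsReducedWord (τ : A →ₚ[ℂ] ℂ) (B : ι → StarSubalgebra ℂ A) (I : Set ι)
    (l : List (ι × A)) : Prop :=
  l.IsChain (fun p q => p.1 ≠ q.1) ∧ ∀ p ∈ l, p.1 ∈ I ∧ p.2 ∈ B p.1 ∧ τ p.2 = 0

/-- The linear span of the products of the reduced words over `I`. -/
noncomputable def reducedSpan (τ : A →ₚ[ℂ] ℂ) (B : ι → StarSubalgebra ℂ A) (I : Set ι) :
    Submodule ℂ A :=
  Submodule.span ℂ {x | ∃ l, IsReducedWord τ B I l ∧ (l.map Prod.snd).prod = x}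

variable {τ : A →ₚ[ℂ] ℂ} {B : ι → StarSubalgebra ℂ A} {I : Set ι}

lemma IsReducedWord.tail {p : ι × A} {l : List (ι × A)} (hl : IsReducedWord τ B I (p :: l)) :
    IsReducedWord τ B I l :=
  ⟨hl.1.tail, fun q hq => hl.2 q (List.mem_cons_of_mem _ hq)⟩

lemma IsReducedWord.prod_mem {l : List (ι × A)} (hl : IsReducedWord τ B I l) :
    (l.map Prod.snd).prod ∈ reducedSpan τ B I :=
  Submodule.subset_span ⟨l, hl, rfl⟩

lemma one_mem_reducedSpan : (1 : A) ∈ reducedSpan τ B I :=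
  IsReducedWord.prod_mem (l := []) ⟨List.isChain_nil, by simp⟩

lemma map_sub_algebraMap_eq_zero (h1 : τ 1 = 1) (b : A) : τ (b - algebraMap ℂ A (τ b)) = 0 := by
  simp [Algebra.algebraMap_eq_smul_one, h1]

/-- Split `b` into its centred part and a scalar. If the word already starts with index `i`, first
absorb that letter into `b`. -/
lemma IsReducedWord.mul_prod_mem (h1 : τ 1 = 1) {i : ι} (hi : i ∈ I) {b : A} (hb : b ∈ B i)
    {l : List (ι × A)} (hl : IsReducedWord τ B I l) :
    b * (l.map Prod.snd).prod ∈ reducedSpan τ B I := by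
  have key : ∀ {b : A}, b ∈ B i → ∀ {l : List (ι × A)}, IsReducedWord τ B I l →
      (∀ p ∈ l.head?, i ≠ p.1) → b * (l.map Prod.snd).prod ∈ reducedSpan τ B I := by
    intro b hb l hl hh
    have hw : IsReducedWord τ B I ((i, b - algebraMap ℂ A (τ b)) :: l) := by
      refine ⟨List.isChain_cons.2 ⟨hh, hl.1⟩, ?_⟩
      rintro p (_ | ⟨_, hp⟩)
      · exact ⟨hi, sub_mem hb (algebraMap_mem _ _), map_sub_algebraMap_eq_zero h1 b⟩
      · exact hl.2 p hp
    have h2 := add_mem hw.prod_mem ((reducedSpan τ B I).smul_mem (τ b) hl.prod_mem)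
    simpa [sub_mul, Algebra.algebraMap_eq_smul_one] using h2
  rcases l with _ | ⟨⟨k, c⟩, l⟩
  · exact key hb hl (by simp)
  · by_cases hk : i = k
    · subst hk
      have hc := (hl.2 _ List.mem_cons_self).2.1
      have := key (mul_mem hb hc) hl.tail (List.isChain_cons.1 hl.1).1
      simpa [mul_assoc] using this
    · exact key hb hl (by simpa using hk)

lemma mem_reducedSpan_of_mem_adjoin (h1 : τ 1 = 1) {z : A}
    (hz : z ∈ Algebra.adjoin ℂ (⋃ i ∈ I, (B i : Set A))) : z ∈ reducedSpan τ B I := by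
  suffices h : ∀ w ∈ reducedSpan τ B I, z * w ∈ reducedSpan τ B I by
    simpa using h 1 one_mem_reducedSpan
  induction hz using Algebra.adjoin_induction with
  | mem b hb =>
    obtain ⟨i, hi, hb⟩ := Set.mem_iUnion₂.1 hb
    intro w hw
    induction hw using Submodule.span_induction with
    | mem x hx =>
      obtain ⟨l, hl, rfl⟩ := hx
      exact hl.mul_prod_mem h1 hi hb
    | zero => simp
    | add x y _ _ hx hy => rw [mul_add]; exact add_mem hx hy
    | smul c x _ hx => rw [mul_smul_comm]; exact Submodule.smul_mem _ _ hx
  | algebraMap r =>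
    intro w hw
    rw [← Algebra.smul_def]
    exact Submodule.smul_mem _ _ hw
  | add x y _ _ hx hy => intro w hw; rw [add_mul]; exact add_mem (hx w hw) (hy w hw)
  | mul x y _ _ hx hy => intro w hw; rw [mul_assoc]; exact hx _ (hy w hw)

variable [StarOrderedRing A]

lemma FreelyIndependentSubalgebras.map_prod_eq_zero (h : FreelyIndependentSubalgebras τ B)
    {l : List (ι × A)} (hl : IsReducedWord τ B I l) (hne : l ≠ []) :
    τ (l.map Prod.snd).prod = 0 := by
  obtain ⟨m, hm⟩ : ∃ m, l.length = m + 1 :=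
    Nat.exists_eq_succ_of_ne_zero (by simpa using hne)
  obtain ⟨f, rfl⟩ : ∃ f : Fin (m + 1) → ι × A, l = List.ofFn f :=
    ⟨fun k => l.get (k.cast hm.symm), by
      apply List.ext_get
      · simp [hm]
      · intro k h1 h2
        simp [-List.ofFn_succ]⟩
  rw [List.map_ofFn]
  refine h m (fun k => (f k).1) (fun k => (f k).2) (fun k => ?_) (fun k => ?_) (fun k => ?_)
  · have := List.isChain_iff_getElem.1 hl.1 k (by simp)
    simp only [List.getElem_ofFn] at this
    exact this
  · exact (hl.2 (f k) (List.mem_ofFn.2 ⟨k, rfl⟩)).2.1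
  · exact (hl.2 (f k) (List.mem_ofFn.2 ⟨k, rfl⟩)).2.2

/-- A centred element whose index lies outside `I` stays centred when it is multiplied on both
sides by elements of the algebra generated by the subalgebras with index in `I`. -/
lemma FreelyIndependentSubalgebras.map_mul_mul_eq_zero (h : FreelyIndependentSubalgebras τ B)
    (h1 : τ 1 = 1) {u v x : A} {j : ι} (hj : j ∉ I)
    (hu : u ∈ Algebra.adjoin ℂ (⋃ i ∈ I, (B i : Set A)))
    (hv : v ∈ Algebra.adjoin ℂ (⋃ i ∈ I, (B i : Set A)))
    (hx : x ∈ B j) (hx0 : τ x = 0) : τ (u * x * v) = 0 := by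
  have hu' := mem_reducedSpan_of_mem_adjoin h1 hu
  have hv' := mem_reducedSpan_of_mem_adjoin h1 hv
  clear hu hv
  induction hu' using Submodule.span_induction with
  | zero => simp
  | add a b _ _ ha hb => rw [add_mul, add_mul, map_add, ha, hb, add_zero]
  | smul c a _ ha => rw [smul_mul_assoc, smul_mul_assoc, map_smul, ha, smul_zero]
  | mem a ha =>
    obtain ⟨l, hl, rfl⟩ := ha
    induction hv' using Submodule.span_induction with
    | zero => simp
    | add a b _ _ ha hb => rw [mul_add, map_add, ha, hb, add_zero]
    | smul c a _ ha => rw [mul_smul_comm, map_smul, ha, smul_zero]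
    | mem a ha =>
      obtain ⟨l', hl', rfl⟩ := ha
      -- Since `j ∉ I`, the letter `x` differs in index from both neighbours, so no reduction
      -- occurs.
      have hw : IsReducedWord τ B Set.univ (l ++ (j, x) :: l') := by
        refine ⟨List.isChain_append.2 ⟨hl.1, List.isChain_cons.2 ⟨?_, hl'.1⟩, ?_⟩, ?_⟩
        · intro p hp hjp
          have := (hl'.2 p (List.mem_of_mem_head? hp)).1
          exact hj (by rwa [← hjp] at this)
        · intro p hp q hq hpq
          obtain rfl : (j, x) = q := by simpa using hq
          have := (hl.2 p (List.mem_of_getLast? hp)).1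
          exact hj (by rwa [hpq] at this)
        · intro p hp
          rcases List.mem_append.1 hp with hp | hp
          · exact ⟨trivial, (hl.2 p hp).2⟩
          · rcases List.mem_cons.1 hp with rfl | hp
            · exact ⟨trivial, hx, hx0⟩
            · exact ⟨trivial, (hl'.2 p hp).2⟩
      simpa [mul_assoc] using h.map_prod_eq_zero hw (by simp)

end Words

/-! ### Compression of the full sum to partial sums -/

section PartialSums

variable {A : Type*} [CStarAlgebra A] [PartialOrder A] [StarOrderedRing A] {τ : A →ₚ[ℂ] ℂ}

/-- Positivity of a self-adjoint `z` can be tested on the `⋆`-algebra which it generates. -/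
lemma IsFaithfulState.nonneg_of_forall_adjoin (hτ : IsFaithfulState τ) {z : A}
    (hz : IsSelfAdjoint z)
    (h : ∀ v ∈ StarAlgebra.adjoin ℂ {z}, 0 ≤ τ (star v * z * v)) : 0 ≤ z := by
  have hcont : Continuous τ := map_continuous τ
  have hcl : IsClosed {v : A | 0 ≤ τ (star v * z * v)} :=
    isClosed_le continuous_const (hcont.comp (by fun_prop))
  -- The test vector is `z⁻`: it lies only in the closure of the algebra, and the hypothesis extends
  -- there by continuity.
  have hmem : z⁻ ∈ StarAlgebra.elemental ℂ z := by
    rw [CFC.negPart_def, cfcₙ_eq_cfc]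
    have := StarAlgebra.elemental.isClosed ℂ z
    exact cfc_mem (𝕜' := ℂ) _ (StarAlgebra.elemental.self_mem ℂ z)
  have hv : 0 ≤ τ (star z⁻ * z * z⁻) :=
    closure_minimal (s := (StarAlgebra.adjoin ℂ {z} : Set A)) h hcl hmem
  have hsa : star z⁻ = z⁻ := (CFC.negPart_nonneg z).isSelfAdjoint.star_eq
  have h3 : star z⁻ * z * z⁻ = -(z⁻ * z⁻ * z⁻) := by
    have h := congrArg (z⁻ * ·) (CFC.posPart_sub_negPart z hz)
    simp only [mul_sub, CFC.negPart_mul_posPart, zero_sub] at h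
    rw [hsa, ← h, neg_mul]
  have hnn : 0 ≤ z⁻ * z⁻ * z⁻ := by
    have := star_left_conjugate_nonneg (CFC.negPart_nonneg z) z⁻
    rwa [hsa] at this
  -- The cube of `z⁻` is positive with `τ`-value both nonnegative and nonpositive, so faithfulness
  -- kills it.
  obtain ⟨w, hw⟩ := CStarAlgebra.nonneg_iff_eq_star_mul_self.1 hnn
  have hw0 : w = 0 := by
    apply hτ.faithful
    rw [h3, map_neg] at hv
    rw [← hw]
    exact le_antisymm (neg_nonneg.1 hv) (τ.map_nonneg hnn)
  have h30 : z⁻ * z⁻ * z⁻ = 0 := by rw [hw, hw0]; simp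
  have h20 : z⁻ * z⁻ = 0 := by
    rw [← CStarRing.star_mul_self_eq_zero_iff, star_mul, hsa, mul_assoc, ← mul_assoc z⁻ z⁻ z⁻,
      h30, mul_zero]
  rw [← CFC.negPart_eq_zero_iff z hz, ← CStarRing.star_mul_self_eq_zero_iff, hsa, h20]

lemma FreelyIndependentSubalgebras.sum_le_algebraMap_of_sum_univ_le {ι : Type*} [Fintype ι]
    [DecidableEq ι]
    (hτ : IsFaithfulState τ) {B : ι → StarSubalgebra ℂ A}
    (hB : FreelyIndependentSubalgebras τ B) {x : ι → A} (hx : ∀ i, x i ∈ B i)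
    (hx0 : ∀ i, τ (x i) = 0) (hsa : ∀ i, IsSelfAdjoint (x i)) {r : ℝ}
    (hr : ∑ i, x i ≤ algebraMap ℝ A r) (s : Finset ι) : ∑ i ∈ s, x i ≤ algebraMap ℝ A r := by
  have hsa' : IsSelfAdjoint (algebraMap ℝ A r - ∑ i ∈ s, x i) :=
    (IsSelfAdjoint.algebraMap A (.all r)).sub (isSelfAdjoint_sum _ fun i _ => hsa i)
  rw [← sub_nonneg]
  refine hτ.nonneg_of_forall_adjoin hsa' fun v hv => ?_
  have hle : (StarAlgebra.adjoin ℂ {algebraMap ℝ A r - ∑ i ∈ s, x i}).toSubalgebra ≤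
      Algebra.adjoin ℂ (⋃ i ∈ (s : Set ι), (B i : Set A)) := by
    rw [StarAlgebra.adjoin_toSubalgebra, Set.star_singleton, hsa'.star_eq, Set.union_self]
    refine Algebra.adjoin_le (Set.singleton_subset_iff.2 (sub_mem ?_ (sum_mem fun i hi => ?_)))
    · rw [IsScalarTower.algebraMap_apply ℝ ℂ A]
      exact algebraMap_mem _ _
    · exact Algebra.subset_adjoin (Set.mem_iUnion₂.2 ⟨i, hi, hx i⟩)
  have hout : τ (star v * (∑ i ∈ sᶜ, x i) * v) = 0 := by
    rw [Finset.mul_sum, Finset.sum_mul, map_sum]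
    refine Finset.sum_eq_zero fun j hj => ?_
    exact hB.map_mul_mul_eq_zero hτ.map_one (I := (s : Set ι)) (by simpa using hj)
      (hle (star_mem (S := StarSubalgebra ℂ A) hv)) (hle hv) (hx j) (hx0 j)
  have hsplit : star v * (algebraMap ℝ A r - ∑ i ∈ s, x i) * v =
      star v * (algebraMap ℝ A r - ∑ i, x i) * v + star v * (∑ i ∈ sᶜ, x i) * v := by
    rw [← Finset.sum_add_sum_compl s x]
    noncomm_ring
  rw [hsplit, map_add, hout, add_zero]
  exact τ.map_nonneg (star_left_conjugate_nonneg (sub_nonneg.2 hr) v)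

end PartialSums

/-! ### Sums of symmetrized words -/

section Expectations

variable {A : Type*} [CStarAlgebra A] {n : ℕ}

lemma symmetrizedWord_eq_star_mul_self {d : ℕ} (x : Fin n → A) (j : Fin d → Fin n) :
    symmetrizedWord x j = star (List.ofFn fun k => x (j k)).reverse.prod *
      (List.ofFn fun k => x (j k)).reverse.prod := by
  have h (l : List A) : star l.reverse.prod = (l.map star).prod := by
    induction l <;> simp_all
  rw [symmetrizedWord, h, List.map_ofFn]
  rfl

/-- The last index is innermost, so summing over it conjugates a partial sum of `star (x i) * x i`,
and order bounds pass through. -/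
lemma symmetrizedWord_snoc {d : ℕ} (x : Fin n → A) (j : Fin d → Fin n) (i : Fin n) :
    symmetrizedWord x (Fin.snoc j i : Fin (d + 1) → Fin n) =
      star (List.ofFn fun k => x (j k)).reverse.prod * (star (x i) * x i) *
        (List.ofFn fun k => x (j k)).reverse.prod := by
  rw [symmetrizedWord_eq_star_mul_self, List.ofFn_succ']
  simp [mul_assoc]

lemma symmetrizedWord_zero (x : Fin n → A) (j : Fin 0 → Fin n) : symmetrizedWord x j = 1 := by
  simp [symmetrizedWord]

lemma sum_embedding_succ {E : Type*} [AddCommMonoid E] (d : ℕ) (f : (Fin (d + 1) → Fin n) → E) :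
    ∑ j : Fin (d + 1) ↪ Fin n, f j =
      ∑ j : Fin d ↪ Fin n, ∑ i ∈ (Finset.univ.map j)ᶜ, f (Fin.snoc j i) := by
  let e : (Fin (d + 1) ↪ Fin n) ≃ (Σ j : Fin d ↪ Fin n, {i // i ∈ (Finset.univ.map j)ᶜ}) :=
    { toFun := fun j => ⟨Fin.Embedding.init j, j (Fin.last d), by
        simp only [Finset.mem_compl, Finset.mem_map, Finset.mem_univ, true_and, not_exists]
        exact fun k hk => Fin.castSucc_ne_last k (j.injective hk)⟩
      invFun := fun p => Fin.Embedding.snoc p.1 (a := p.2.1) (by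
        rintro ⟨k, hk⟩
        exact Finset.mem_compl.1 p.2.2 (hk ▸ Finset.mem_map_of_mem _ (Finset.mem_univ k)))
      left_inv := fun j => DFunLike.coe_injective (Fin.snoc_init_self (j : Fin (d + 1) → Fin n))
      right_inv := fun p => by
        obtain ⟨j, i, hi⟩ := p
        have h1 : Fin.Embedding.init (Fin.Embedding.snoc j (a := i) (by
            rintro ⟨k, hk⟩
            exact Finset.mem_compl.1 hi (hk ▸ Finset.mem_map_of_mem _ (Finset.mem_univ k)))) = j :=
          Fin.Embedding.init_snoc _ _
        refine Sigma.ext h1 ?_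
        exact (Subtype.heq_iff_coe_eq (by simp [h1])).2 Fin.Embedding.snoc_last }
  rw [← e.symm.sum_comp, Fintype.sum_sigma]
  refine Finset.sum_congr rfl fun j _ => ?_
  rw [← Finset.sum_coe_sort (Finset.univ.map j)ᶜ]
  rfl

lemma sum_fun_succ {E : Type*} [AddCommMonoid E] (d : ℕ) (f : (Fin (d + 1) → Fin n) → E) :
    ∑ j : Fin (d + 1) → Fin n, f j = ∑ j : Fin d → Fin n, ∑ i, f (Fin.snoc j i) := by
  rw [← (Fin.snocEquiv fun _ => Fin n).sum_comp, Fintype.sum_prod_type, Finset.sum_comm]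
  rfl

lemma expectationWO_eq_real_smul (d : ℕ) (x : Fin n → A) :
    expectationWO d x =
      ((n - d)! / n ! : ℝ) • ∑ j : Fin d ↪ Fin n, symmetrizedWord x j := by
  rw [expectationWO, ← Complex.coe_smul]
  norm_num

lemma expectationWR_eq_real_smul (d : ℕ) (x : Fin n → A) :
    expectationWR d x = ((n : ℝ) ^ d)⁻¹ • ∑ j : Fin d → Fin n, symmetrizedWord x j := by
  rw [expectationWR, ← Complex.coe_smul]
  norm_num

lemma expectationWO_zero (x : Fin n → A) : expectationWO 0 x = 1 := by
  have : (n ! : ℝ) ≠ 0 := by positivity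
  simp [expectationWO_eq_real_smul, symmetrizedWord_zero, this]

lemma expectationWR_zero (x : Fin n → A) : expectationWR 0 x = 1 := by
  simp [expectationWR_eq_real_smul, symmetrizedWord_zero]

variable [PartialOrder A] [StarOrderedRing A]

lemma symmetrizedWord_nonneg {d : ℕ} (x : Fin n → A) (j : Fin d → Fin n) :
    0 ≤ symmetrizedWord x j := by
  rw [symmetrizedWord_eq_star_mul_self]
  exact star_mul_self_nonneg _

lemma sum_embedding_nonneg (d : ℕ) (x : Fin n → A) :
    0 ≤ ∑ j : Fin d ↪ Fin n, symmetrizedWord x j :=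
  Finset.sum_nonneg fun j _ => symmetrizedWord_nonneg x j

lemma sum_fun_nonneg (d : ℕ) (x : Fin n → A) :
    0 ≤ ∑ j : Fin d → Fin n, symmetrizedWord x j :=
  Finset.sum_nonneg fun j _ => symmetrizedWord_nonneg x j

lemma expectationWO_nonneg (d : ℕ) (x : Fin n → A) : 0 ≤ expectationWO d x := by
  rw [expectationWO_eq_real_smul]
  exact smul_nonneg (by positivity) (sum_embedding_nonneg d x)

lemma sum_symmetrizedWord_snoc_le {d : ℕ} (x : Fin n → A) (j : Fin d → Fin n) {s : Finset (Fin n)}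
    {r : ℝ} (h : ∑ i ∈ s, star (x i) * x i ≤ algebraMap ℝ A r) :
    ∑ i ∈ s, symmetrizedWord x (Fin.snoc j i : Fin (d + 1) → Fin n) ≤
      r • symmetrizedWord x j := by
  simp_rw [symmetrizedWord_snoc, ← Finset.sum_mul, ← Finset.mul_sum]
  refine (star_left_conjugate_le_conjugate h _).trans_eq ?_
  rw [symmetrizedWord_eq_star_mul_self, Algebra.algebraMap_eq_smul_one]
  simp

lemma le_sum_symmetrizedWord_snoc {d : ℕ} (x : Fin n → A) (j : Fin d → Fin n) {s : Finset (Fin n)}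
    {r : ℝ} (h : algebraMap ℝ A r ≤ ∑ i ∈ s, star (x i) * x i) :
    r • symmetrizedWord x j ≤
      ∑ i ∈ s, symmetrizedWord x (Fin.snoc j i : Fin (d + 1) → Fin n) := by
  simp_rw [symmetrizedWord_snoc, ← Finset.sum_mul, ← Finset.mul_sum]
  refine Eq.trans_le ?_ (star_left_conjugate_le_conjugate h _)
  rw [symmetrizedWord_eq_star_mul_self, Algebra.algebraMap_eq_smul_one]
  simp

/-- Uniform control of the partial sums of `x i⋆ x i - 1`. -/
def PartialSumsBounded (x : Fin n → A) (r : ℝ) : Prop :=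
  ∀ s : Finset (Fin n), algebraMap ℝ A (s.card - r) ≤ ∑ i ∈ s, star (x i) * x i ∧
    ∑ i ∈ s, star (x i) * x i ≤ algebraMap ℝ A (s.card + r)

/-! ### Recursive order bounds for the expectations -/

lemma card_compl_map_univ {d : ℕ} (j : Fin d ↪ Fin n) :
    (((Finset.univ.map j)ᶜ.card : ℕ) : ℝ) = n - d := by
  have hd : d ≤ n := by simpa using Fintype.card_le_of_embedding j
  rw [Finset.card_compl]
  simp [Nat.cast_sub hd]

lemma PartialSumsBounded.sum_embedding_succ_le {x : Fin n → A} {r : ℝ}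
    (h : PartialSumsBounded x r) (d : ℕ) :
    ∑ j : Fin (d + 1) ↪ Fin n, symmetrizedWord x j ≤
      ((n - d : ℝ) + r) • ∑ j : Fin d ↪ Fin n, symmetrizedWord x j := by
  rw [sum_embedding_succ, Finset.smul_sum]
  refine Finset.sum_le_sum fun j _ => sum_symmetrizedWord_snoc_le x j ?_
  rw [← card_compl_map_univ j]
  exact (h _).2

lemma PartialSumsBounded.le_sum_embedding_succ {x : Fin n → A} {r : ℝ}
    (h : PartialSumsBounded x r) (d : ℕ) :
    ((n - d : ℝ) - r) • ∑ j : Fin d ↪ Fin n, symmetrizedWord x j ≤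
      ∑ j : Fin (d + 1) ↪ Fin n, symmetrizedWord x j := by
  rw [sum_embedding_succ, Finset.smul_sum]
  refine Finset.sum_le_sum fun j _ => le_sum_symmetrizedWord_snoc x j ?_
  rw [← card_compl_map_univ j]
  exact (h _).1

lemma factorial_ratio_succ {d : ℕ} (hd : d < n) :
    ((n - d)! / n ! : ℝ) = (n - d) * ((n - (d + 1))! / n !) := by
  obtain ⟨k, rfl⟩ := Nat.exists_eq_add_of_lt hd
  have h1 : d + k + 1 - d = k + 1 := by omega
  have h2 : d + k + 1 - (d + 1) = k := by omega
  rw [h1, h2, Nat.factorial_succ]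
  push_cast
  ring

lemma PartialSumsBounded.expectationWO_succ_le {x : Fin n → A} {ε : ℝ} (hε : 0 ≤ ε)
    (h : PartialSumsBounded x (n * ε)) {d : ℕ} (hd : 2 * (d + 1) ≤ n) :
    expectationWO (d + 1) x ≤ (1 + 2 * ε) • expectationWO d x := by
  have hd' : (2 * (d + 1) : ℝ) ≤ n := by exact_mod_cast hd
  rw [expectationWO_eq_real_smul, expectationWO_eq_real_smul,
    factorial_ratio_succ (d := d) (by omega)]
  refine (smul_le_smul_of_nonneg_left (h.sum_embedding_succ_le d) (by positivity)).trans ?_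
  rw [smul_smul, smul_smul]
  refine smul_le_smul_of_nonneg_right ?_ (sum_embedding_nonneg d x)
  -- Uses `n ≤ 2 * (n - d)`.
  have : (n - d : ℝ) + n * ε ≤ (1 + 2 * ε) * (n - d) := by nlinarith
  calc _ ≤ ((n - (d + 1))! / n ! : ℝ) * ((1 + 2 * ε) * (n - d)) := by gcongr
    _ = _ := by ring

lemma PartialSumsBounded.le_expectationWO_succ {x : Fin n → A} {ε : ℝ} (hε : 0 ≤ ε)
    (h : PartialSumsBounded x (n * ε)) {d : ℕ} (hd : 2 * (d + 1) ≤ n) :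
    (1 - 2 * ε) • expectationWO d x ≤ expectationWO (d + 1) x := by
  have hd' : (2 * (d + 1) : ℝ) ≤ n := by exact_mod_cast hd
  rw [expectationWO_eq_real_smul, expectationWO_eq_real_smul,
    factorial_ratio_succ (d := d) (by omega)]
  refine le_trans ?_ (smul_le_smul_of_nonneg_left (h.le_sum_embedding_succ d) (by positivity))
  rw [smul_smul, smul_smul]
  refine smul_le_smul_of_nonneg_right ?_ (sum_embedding_nonneg d x)
  have : (1 - 2 * ε) * (n - d) ≤ (n - d : ℝ) - n * ε := by nlinarith
  calc _ = ((n - (d + 1))! / n ! : ℝ) * ((1 - 2 * ε) * (n - d)) := by ring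
    _ ≤ _ := by gcongr

lemma PartialSumsBounded.expectationWO_le {x : Fin n → A} {ε : ℝ} (hε : 0 ≤ ε)
    (h : PartialSumsBounded x (n * ε)) {d : ℕ} (hd : 2 * d ≤ n) :
    expectationWO d x ≤ algebraMap ℝ A ((1 + 2 * ε) ^ d) := by
  induction d with
  | zero => simp [expectationWO_zero]
  | succ d ih =>
    refine (h.expectationWO_succ_le hε hd).trans
      ((smul_le_smul_of_nonneg_left (ih (by omega)) (by positivity)).trans_eq ?_)
    rw [Algebra.smul_def, ← map_mul, pow_succ']

/-- Iterating the factor `1 - 2 * ε` would need it nonnegative. Instead the loss `2 * ε` times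
`expectationWO d x` is estimated by the upper bound, and the losses telescope. -/
lemma PartialSumsBounded.le_expectationWO {x : Fin n → A} {ε : ℝ} (hε : 0 ≤ ε)
    (h : PartialSumsBounded x (n * ε)) {d : ℕ} (hd : 2 * d ≤ n) :
    algebraMap ℝ A (2 - (1 + 2 * ε) ^ d) ≤ expectationWO d x := by
  induction d with
  | zero => rw [expectationWO_zero, pow_zero, show (2 - 1 : ℝ) = 1 by norm_num, map_one]
  | succ d ih =>
    have h1 := h.le_expectationWO_succ hε hd
    have h2 : (2 * ε) • expectationWO d x ≤ algebraMap ℝ A (2 * ε * (1 + 2 * ε) ^ d) := by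
      rw [map_mul, ← Algebra.smul_def]
      exact smul_le_smul_of_nonneg_left (h.expectationWO_le hε (by omega)) (by positivity)
    have h3 : (2 - (1 + 2 * ε) ^ (d + 1)) =
      (2 - (1 + 2 * ε) ^ d) - 2 * ε * (1 + 2 * ε) ^ d := by ring
    rw [h3, map_sub]
    rw [sub_smul, one_smul] at h1
    exact (sub_le_sub (ih (by omega)) h2).trans h1

lemma PartialSumsBounded.le_expectationWR {x : Fin n → A} {ε : ℝ} (hε1 : ε ≤ 1)
    (h : PartialSumsBounded x (n * ε)) (hn : 0 < n) (d : ℕ) :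
    algebraMap ℝ A ((1 - ε) ^ d) ≤ expectationWR d x := by
  induction d with
  | zero => simp [expectationWR_zero]
  | succ d ih =>
    have hstep : (1 - ε) • expectationWR d x ≤ expectationWR (d + 1) x := by
      have hsum : (n * (1 - ε) : ℝ) • ∑ j : Fin d → Fin n, symmetrizedWord x j ≤
          ∑ j : Fin (d + 1) → Fin n, symmetrizedWord x j := by
        rw [sum_fun_succ, Finset.smul_sum]
        refine Finset.sum_le_sum fun j _ => le_sum_symmetrizedWord_snoc x j ?_
        have := (h Finset.univ).1
        rwa [Finset.card_univ, Fintype.card_fin, show (n - n * ε : ℝ) = n * (1 - ε) by ring]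
          at this
      rw [expectationWR_eq_real_smul, expectationWR_eq_real_smul]
      refine Eq.trans_le ?_ (smul_le_smul_of_nonneg_left hsum (by positivity))
      rw [smul_smul, smul_smul]
      congr 1
      field_simp
      ring
    refine le_trans ?_ hstep
    rw [pow_succ', map_mul, ← Algebra.smul_def]
    exact smul_le_smul_of_nonneg_left ih (by linarith)

lemma sum_embedding_le_sum_fun (d : ℕ) (x : Fin n → A) :
    ∑ j : Fin d ↪ Fin n, symmetrizedWord x j ≤ ∑ j : Fin d → Fin n, symmetrizedWord x j := by
  refine (Finset.sum_map Finset.univ ⟨fun j : Fin d ↪ Fin n => (j : Fin d → Fin n),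
    DFunLike.coe_injective⟩ (symmetrizedWord x)).symm.trans_le ?_
  exact Finset.sum_le_sum_of_subset_of_nonneg (Finset.subset_univ _)
    fun j _ _ => symmetrizedWord_nonneg x j

/-- Each of the `d` factors of `n! / (n - d)!` is at least `n + 1 - d`, hence at least `n / 2`. -/
lemma expectationWO_le_two_pow_smul_expectationWR {d : ℕ} (hd : 2 * d ≤ n) (x : Fin n → A) :
    expectationWO d x ≤ (2 ^ d : ℝ) • expectationWR d x := by
  rcases Nat.eq_zero_or_pos d with rfl | hd0
  · simp [expectationWO_zero, expectationWR_zero]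
  have hn : 0 < n := by omega
  rw [expectationWO_eq_real_smul, expectationWR_eq_real_smul, smul_smul]
  refine (smul_le_smul_of_nonneg_left (sum_embedding_le_sum_fun d x) (by positivity)).trans
    (smul_le_smul_of_nonneg_right ?_ (sum_fun_nonneg d x))
  have hN : n ^ d * (n - d)! ≤ 2 ^ d * n ! := by
    rw [← Nat.factorial_mul_descFactorial (show d ≤ n by omega)]
    calc n ^ d * (n - d)! ≤ (2 * (n + 1 - d)) ^ d * (n - d)! := by gcongr; omega
      _ = 2 ^ d * ((n - d)! * (n + 1 - d) ^ d) := by rw [mul_pow]; ring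
      _ ≤ _ := by gcongr; exact Nat.pow_sub_le_descFactorial n d
  have hR : ((n : ℝ) ^ d * (n - d)!) ≤ 2 ^ d * n ! := by exact_mod_cast hN
  rw [← div_eq_mul_inv, div_le_div_iff₀ (by positivity) (by positivity)]
  linarith

lemma IsSelfAdjoint.norm_le_of_neg_le_of_le {y : A} {r : ℝ} (hr : 0 ≤ r)
    (h1 : -algebraMap ℝ A r ≤ y) (h2 : y ≤ algebraMap ℝ A r) (hy : IsSelfAdjoint y) :
    ‖y‖ ≤ r := by
  rcases subsingleton_or_nontrivial A with _ | _
  · simpa [Subsingleton.elim y 0] using hr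
  rw [← map_neg, algebraMap_le_iff_le_spectrum (a := y)] at h1
  rw [le_algebraMap_iff_spectrum_le (a := y)] at h2
  rcases CStarAlgebra.norm_or_neg_norm_mem_spectrum hy with h | h
  · exact h2 _ h
  · linarith [h1 _ h]

/-- The one-sided bound is applied to the centred elements and to their negatives. -/
lemma FreelyIndependent.partialSumsBounded {τ : A →ₚ[ℂ] ℂ} (hτ : IsFaithfulState τ) {a : Fin n → A}
    (ha : FreelyIndependent τ a) (ha1 : ∀ i, τ (star (a i) * a i) = 1) :
    PartialSumsBounded a ‖∑ i, star (a i) * a i - algebraMap ℂ A (τ (∑ i, star (a i) * a i))‖ := by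
  have hτs : τ (∑ i, star (a i) * a i) = n := by simp [map_sum, ha1]
  set y := ∑ i, star (a i) * a i - algebraMap ℂ A (τ (∑ i, star (a i) * a i)) with hy
  have hyx : y = ∑ i, (star (a i) * a i - 1) := by
    simp [hy, hτs]
  have hmem (i) : star (a i) * a i - 1 ∈ StarAlgebra.adjoin ℂ {a i} := by
    have := StarAlgebra.self_mem_adjoin_singleton ℂ (a i)
    exact sub_mem (mul_mem (star_mem this) this) (one_mem _)
  have hτ0 (i) : τ (star (a i) * a i - 1) = 0 := by rw [map_sub, ha1, hτ.map_one, sub_self]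
  have hsa (i) : IsSelfAdjoint (star (a i) * a i - 1) :=
    (IsSelfAdjoint.star_mul_self _).sub (.one A)
  have hysa : IsSelfAdjoint y := hyx ▸ isSelfAdjoint_sum _ fun i _ => hsa i
  intro s
  have hu := ha.sum_le_algebraMap_of_sum_univ_le hτ hmem hτ0 hsa (r := ‖y‖)
    (by rw [← hyx]; exact hysa.le_algebraMap_norm_self) s
  have hl := ha.sum_le_algebraMap_of_sum_univ_le hτ (fun i => neg_mem (hmem i))
    (fun i => by rw [map_neg, hτ0, neg_zero]) (fun i => (hsa i).neg) (r := ‖y‖)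
    (by rw [Finset.sum_neg_distrib, ← hyx]; exact neg_le.1 hysa.neg_algebraMap_norm_le_self) s
  rw [Finset.sum_neg_distrib, Finset.sum_sub_distrib] at hl
  rw [Finset.sum_sub_distrib] at hu
  simp only [Finset.sum_const, nsmul_eq_mul, mul_one] at hl hu
  rw [map_sub, map_add, map_natCast]
  exact ⟨by rw [neg_sub, sub_le_comm] at hl; exact hl, sub_le_iff_le_add'.1 hu⟩

lemma PartialSumsBounded.mono {x : Fin n → A} {r r' : ℝ} (h : PartialSumsBounded x r)
    (hr : r ≤ r') : PartialSumsBounded x r' := fun s =>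
  ⟨(algebraMap_mono A (by linarith)).trans (h s).1,
    (h s).2.trans (algebraMap_mono A (by linarith))⟩

lemma norm_sub_algebraMap_map_le {τ : A →ₚ[ℂ] ℂ} (h1 : τ 1 = 1) {y : A} {p q : ℝ} (hpq : p ≤ q)
    (hp : algebraMap ℝ A p ≤ y) (hq : y ≤ algebraMap ℝ A q) :
    ‖y - algebraMap ℂ A (τ y)‖ ≤ q - p := by
  have hr (r : ℝ) : τ (algebraMap ℝ A r) = r := by
    rw [IsScalarTower.algebraMap_apply ℝ ℂ A, Algebra.algebraMap_eq_smul_one, map_smul, h1]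
    simp
  have hτp := OrderHomClass.mono τ hp
  have hτq := OrderHomClass.mono τ hq
  rw [hr] at hτp hτq
  obtain ⟨t, ht⟩ : ∃ t : ℝ, τ y = t :=
    ⟨(τ y).re, Complex.ext rfl (by simpa using (Complex.le_def.1 hτp).2.symm)⟩
  rw [ht] at hτp hτq ⊢
  have hpt : p ≤ t := by exact_mod_cast hτp
  have htq : t ≤ q := by exact_mod_cast hτq
  have hys : IsSelfAdjoint y := by
    have := (IsSelfAdjoint.of_nonneg (sub_nonneg.2 hp)).add (IsSelfAdjoint.algebraMap A (.all p))
    simpa using this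
  have hcast : algebraMap ℂ A t = algebraMap ℝ A t :=
    (IsScalarTower.algebraMap_apply ℝ ℂ A t).symm
  rw [hcast]
  refine IsSelfAdjoint.norm_le_of_neg_le_of_le (by linarith) ?_ ?_
    (hys.sub (IsSelfAdjoint.algebraMap A (.all t)))
  · rw [le_sub_iff_add_le, ← map_neg, ← map_add]
    exact (algebraMap_mono A (by linarith)).trans hp
  · rw [sub_le_iff_le_add, ← map_add]
    exact hq.trans (algebraMap_mono A (by linarith))

lemma one_add_two_mul_pow_le {ε M : ℝ} {d : ℕ} (hε : 0 ≤ ε) (hM : d * ε ≤ M) :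
    (1 + 2 * ε) ^ d ≤ 1 + 2 * (d * ε) * Real.exp (2 * M) := by
  set t := 2 * (d * ε)
  have ht : 0 ≤ t := by positivity
  have h1 : (1 + 2 * ε) ^ d ≤ Real.exp t := by
    calc (1 + 2 * ε) ^ d ≤ Real.exp (2 * ε) ^ d := by
          gcongr; linarith [Real.add_one_le_exp (2 * ε)]
      _ = Real.exp t := by rw [← Real.exp_nat_mul]; congr 1; ring
  have h2 : Real.exp t ≤ 1 + t * Real.exp t := by
    have := mul_le_mul_of_nonneg_right (Real.add_one_le_exp (-t)) (Real.exp_pos t).le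
    rw [← Real.exp_add, neg_add_cancel, Real.exp_zero] at this
    linarith
  have h3 : Real.exp t ≤ Real.exp (2 * M) := Real.exp_le_exp.2 (by linarith)
  calc _ ≤ _ := h1.trans h2
    _ ≤ _ := by gcongr

end Expectations

/-! ### Assembly of the two estimates -/

theorem mainTheorem5 :
    ∀ M : ℝ, ∃ K : ℝ, ∀ (A : Type*) [CStarAlgebra A] [PartialOrder A] [StarOrderedRing A]
      (τ : A →ₚ[ℂ] ℂ), IsFaithfulState τ →
      ∀ (n d : ℕ) (ε : ℝ) (a : Fin n → A),
        FreelyIndependent τ a →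
        (∀ i, τ (star (a i) * a i) = 1) →
        (1 / (n : ℝ)) *
            ‖∑ i, star (a i) * a i - algebraMap ℂ A (τ (∑ i, star (a i) * a i))‖ ≤ ε →
        2 * d ≤ n →
        (d : ℝ) * ε ≤ M →
        ‖expectationWO d a - algebraMap ℂ A (τ (expectationWO d a))‖ ≤ K * ((d : ℝ) * ε) ∧
        ‖expectationWO d a‖ ≤ (1 + K * ((d : ℝ) * ε)) * ‖expectationWR d a‖ := by
  intro M
  -- Dictated by `(1 + 2 * ε) ^ (2 * d) ≤ 1 + 2 * (2 * d * ε) * exp (2 * (2 * M))`.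
  refine ⟨4 * Real.exp (4 * M), ?_⟩
  intro A _ _ _ τ hτ n d ε a ha ha1 hε hd hM
  have : Nontrivial A := by
    by_contra h
    rw [not_nontrivial_iff_subsingleton] at h
    have := hτ.map_one
    rw [Subsingleton.elim (1 : A) 0, map_zero] at this
    exact zero_ne_one this
  have hε0 : 0 ≤ ε := le_trans (by positivity) hε
  rcases Nat.eq_zero_or_pos d with rfl | hd0
  · simp [expectationWO_zero, expectationWR_zero, hτ.map_one]
  have hn : 0 < n := by omega
  have hb : PartialSumsBounded a (n * ε) := by
    refine (ha.partialSumsBounded hτ ha1).mono ?_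
    rw [one_div, inv_mul_le_iff₀ (by positivity)] at hε
    exact hε
  have hM0 : 0 ≤ M := le_trans (by positivity) hM
  have hup := hb.expectationWO_le hε0 hd
  have hlo := hb.le_expectationWO hε0 hd
  have hβ := one_add_two_mul_pow_le hε0 hM
  have hβ1 : 1 ≤ (1 + 2 * ε) ^ d := one_le_pow₀ (by linarith)
  have hexp : Real.exp (2 * M) ≤ Real.exp (4 * M) := Real.exp_le_exp.2 (by linarith)
  have hdε : 0 ≤ (d : ℝ) * ε := by positivity
  constructor
  -- The two scalar bounds differ by `2 * ((1 + 2 * ε) ^ d - 1)`.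
  · refine (norm_sub_algebraMap_map_le hτ.map_one (by linarith) hlo hup).trans ?_
    nlinarith
  rcases le_total ε (1 / 2) with hε2 | hε2
  · have h1 : ‖expectationWO d a‖ ≤ (1 + 2 * ε) ^ d :=
      (CStarAlgebra.norm_le_iff_le_algebraMap _ (by positivity) (expectationWO_nonneg d a)).2 hup
    have h2 : (1 - ε) ^ d ≤ ‖expectationWR d a‖ := by
      have h0 : (0 : ℝ) ≤ (1 - ε) ^ d := pow_nonneg (by linarith) d
      have := CStarAlgebra.norm_le_norm_of_nonneg_of_le (algebraMap_nonneg A h0)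
        (hb.le_expectationWR (by linarith) hn d)
      rwa [norm_algebraMap', Real.norm_of_nonneg h0] at this
    -- `(1 - ε) * (1 + 2 * ε) = 1 + ε * (1 - 2 * ε)`, which is at least `1` exactly because `0 ≤ ε ≤
    -- 1 / 2`.
    have h3 : 1 ≤ (1 - ε) ^ d * (1 + 2 * ε) ^ d := by
      rw [← mul_pow]
      exact one_le_pow₀ (by nlinarith)
    have h4 : (1 + 2 * ε) ^ d * (1 + 2 * ε) ^ d ≤ 1 + 4 * Real.exp (4 * M) * (d * ε) := by
      have := one_add_two_mul_pow_le (d := 2 * d) (M := 2 * M) hε0 (by push_cast; linarith)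
      rw [show 2 * (2 * M) = 4 * M by ring, two_mul d, pow_add] at this
      push_cast at this
      linarith
    calc ‖expectationWO d a‖ ≤ (1 + 2 * ε) ^ d * 1 := by simpa using h1
      _ ≤ (1 + 2 * ε) ^ d * (‖expectationWR d a‖ * (1 + 2 * ε) ^ d) := by
        gcongr
        exact h3.trans (by gcongr)
      _ = (1 + 2 * ε) ^ d * (1 + 2 * ε) ^ d * ‖expectationWR d a‖ := by ring
      _ ≤ _ := by gcongr
  -- For `ε ≥ 1 / 2`, `d ≤ 2 * M` bounds `2 ^ d`, while `d * ε ≥ 1 / 2` keeps the error term large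
  -- enough to absorb it.
  · have h1 := CStarAlgebra.norm_le_norm_of_nonneg_of_le (expectationWO_nonneg d a)
      (expectationWO_le_two_pow_smul_expectationWR hd a)
    rw [norm_smul, Real.norm_of_nonneg (by positivity)] at h1
    refine h1.trans (mul_le_mul_of_nonneg_right ?_ (norm_nonneg _))
    have hd2 : (d : ℝ) ≤ 2 * M := by nlinarith [(Nat.cast_nonneg d : (0 : ℝ) ≤ d)]
    have hdε2 : 1 / 2 ≤ (d : ℝ) * ε := by
      have : (1 : ℝ) ≤ d := by exact_mod_cast hd0
      nlinarith
    have h2 : (2 : ℝ) ^ d ≤ Real.exp (4 * M) := by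
      calc (2 : ℝ) ^ d ≤ Real.exp 1 ^ d := by
            gcongr; linarith [Real.add_one_le_exp (1 : ℝ)]
        _ = Real.exp d := by rw [← Real.exp_nat_mul, mul_one]
        _ ≤ _ := Real.exp_le_exp.2 (by linarith)
    nlinarith [Real.exp_pos (4 * M)]
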